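/- Let $m\ge 2$ be an odd integer. For an integer $n$ with $\gcd(n,m)=1$ let $Q_m(n)\in\{0,1,\dots,m-1\}$ be the Euler quotient, defined by $Q_m(n)\equiv \frac{n^{\varphi(m)}-1}{m} \pmod m$, where $\varphi$ is Euler's totient function; put $Q_m(n)=0$ if $\gcd(n,m)>1$. For a prime $p>2$ and an integer $\tau\ge 1$ define the binary sequence $\widetilde{s}=(\widetilde s_t)_{t\ge 0}$ by $\widetilde s_t=0$ if $0\le Q_{p^\tau}(t)/p^\tau<\frac12$ and $\widetilde s_t=1$ if $\frac12\le Q_{p^\tau}(t)/p^\tau<1$. Then $\widetilde s$ is $p^{\tau+1}$-periodic, and $$ \sum_{t=0}^{p^{\tau+1}-1}(-1)^{\widetilde{s}_t+\widetilde{s}_{t+p^{\tau}}+\widetilde{s}_{t+2p^{\tau}}+\widetilde{s}_{t+3p^{\tau}}} =\frac{1}{3}p^{\tau+1}+O\left(p^{\tau+\frac{1}{2}}(\log p^{\tau})^4\right) $$ with an absolute implied constant. Consequently the periodic correlation measure of order $4$, $$ \theta_4(\widetilde s)=\max_{0\le d_1<d_2<d_3<d_4<p^{\tau+1}}\left|\sum_{n=0}^{p^{\tau+1}-1}(-1)^{\widetilde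 s_{n+d_1}+\widetilde s_{n+d_2}+\widetilde s_{n+d_3}+\widetilde s_{n+d_4}}\right|, $$ is very large: there is an absolute constant $C>0$ such that $\theta_4(\widetilde s)\ge \frac13 p^{\tau+1}-C\,p^{\tau+\frac12}(\log p^\tau)^4$ for all such $p$ and $\tau$. -/

import Mathlib

/-- The Euler quotient `Q_m(n)`: the residue in `{0, …, m - 1}` of `(n ^ φ(m) - 1) / m` modulo `m`
when `gcd(n, m) = 1` (the division is then exact, by Euler's theorem), and `0` otherwise. -/
def eulerQuotient (m : ℕ) (n : ℤ) : ℤ :=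
  if Int.gcd n m = 1 then ((n ^ Nat.totient m - 1) / (m : ℤ)) % (m : ℤ) else 0

/-- The binary sequence `s_t` obtained by thresholding `Q_m(t) / m ∈ [0, 1)` at `1 / 2`. -/
def eulerQuotientSeq (m : ℕ) (t : ℕ) : ℕ :=
  if (eulerQuotient m t : ℚ) / (m : ℚ) < 1 / 2 then 0 else 1

/-- The periodic correlation measure of order `k` of a `T`-periodic binary sequence `s`: the maximum
of `|∑_{n < T} (-1) ^ (s_{n + d_1} + ⋯ + s_{n + d_k})|` over `0 ≤ d_1 < ⋯ < d_k < T`,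
the lag vectors being the strictly increasing maps `Fin k ↪o Fin T`. -/
noncomputable def periodicCorrelationMeasure (s : ℕ → ℕ) (T k : ℕ) : ℝ :=
  ⨆ d : Fin k ↪o Fin T,
    |∑ n ∈ Finset.range T, (-1 : ℝ) ^ (∑ i : Fin k, s (n + (d i : ℕ)))|

open Finset

/-! With `m = p ^ (r + 1)`, translating `n` by `k * m` changes the Euler quotient by a multiple of
`p ^ r`, so only its leading base-`p` digit moves, by `-k / n` mod `p` (`doubledDigit_add_mul_pow`).
Thresholding at one half reads off the parity of the least residue of twice that digit, except at
the middle digit (`neg_one_pow_eulerQuotientSeq`).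

Hence in each class `n` mod `m` with `p ∤ n` the correlation equals, up to 8, that of residue
parities along progressions of step `-2 / n`. This is an explicit piecewise linear function of the
step, with mean about `p / 3` (`abs_sum_progressionCorrelation_sub_le`). The steps are
equidistributed mod `p`, so the argument is elementary, needs no exponential sums, and gives an
error `12 * p ^ τ`. -/

/-! ### Residue parities along four-term progressions -/

/-- The sign `(-1) ^ r`, where `r ∈ {0, …, p - 1}` is the least residue of `z`. -/
noncomputable def residueSign {p : ℕ} (z : ZMod p) : ℝ := (-1) ^ z.val

lemma abs_residueSign {p : ℕ} (z : ZMod p) : |residueSign z| = 1 := by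
  simp [residueSign]

/-- The product of the residue signs along a four-term progression. -/
noncomputable def progressionSign {p : ℕ} (y v : ZMod p) : ℝ :=
  residueSign y * residueSign (y + v) * residueSign (y + 2 * v) * residueSign (y + 3 * v)

/-- Since `p` is odd, each subtraction of `p` flips the parity. -/
lemma residueSign_natCast {p N c : ℕ} (hp : Odd p) (h1 : c * p ≤ N) (h2 : N < (c + 1) * p) :
    residueSign (N : ZMod p) = (-1) ^ (N + c) := by
  have hp0 : 0 < p := hp.pos
  have hmod : N % p + c * p = N := by
    have : N / p = c := Nat.div_eq_of_lt_le h1 h2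
    rw [← this, mul_comm]; exact Nat.mod_add_div N p
  have hr : N + c = N % p + c * (p + 1) := by rw [mul_add, ← add_assoc, hmod, mul_one]
  have he : Even (c * (p + 1)) := (hp.add_one).mul_left c
  rw [residueSign, ZMod.val_natCast, hr, pow_add, he.neg_one_pow, mul_one]

lemma sum_range_natCast_zmod {p : ℕ} [NeZero p] {M : Type*} [AddCommMonoid M] (f : ZMod p → M) :
    ∑ k ∈ range p, f (k : ZMod p) = ∑ x, f x := by
  refine sum_bij' (fun k _ => (k : ZMod p)) (fun x _ => x.val) ?_ ?_ ?_ ?_ ?_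
  · simp
  · intro x _; simpa using x.val_lt
  · intro k hk; simpa using ZMod.val_cast_of_lt (mem_range.1 hk)
  · intro x _; simp
  · simp

/-- No term of the progression crosses a multiple of `p` while `y` stays in the interval. The four
terms add up to the even number `4y + 6v`, so only the wrap counts `cᵢ` affect the sign. -/
lemma sum_Ico_progressionSign {p v a b c₁ c₂ c₃ : ℕ} (hp : Odd p) (hab : a ≤ b) (hb : b ≤ p)
    (h1 : c₁ * p ≤ a + v) (h1' : b + v ≤ (c₁ + 1) * p)
    (h2 : c₂ * p ≤ a + 2 * v) (h2' : b + 2 * v ≤ (c₂ + 1) * p)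
    (h3 : c₃ * p ≤ a + 3 * v) (h3' : b + 3 * v ≤ (c₃ + 1) * p) :
    ∑ y ∈ Ico a b, progressionSign (y : ZMod p) (v : ZMod p) =
      (-1) ^ (c₁ + c₂ + c₃) * ((b : ℝ) - a) := by
  have key : ∀ y ∈ Ico a b, progressionSign (y : ZMod p) (v : ZMod p) =
      (-1) ^ (c₁ + c₂ + c₃) := by
    intro y hy
    obtain ⟨hy1, hy2⟩ := mem_Ico.1 hy
    have e0 := residueSign_natCast (N := y) (c := 0) hp (by omega) (by omega)
    have e1 := residueSign_natCast (N := y + v) (c := c₁) hp (by omega) (by omega)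
    have e2 := residueSign_natCast (N := y + 2 * v) (c := c₂) hp (by omega) (by omega)
    have e3 := residueSign_natCast (N := y + 3 * v) (c := c₃) hp (by omega) (by omega)
    push_cast at e1 e2 e3
    rw [progressionSign, e0, e1, e2, e3, ← pow_add, ← pow_add, ← pow_add]
    have : y + 0 + (y + v + c₁) + (y + 2 * v + c₂) + (y + 3 * v + c₃) =
      2 * (2 * y + 3 * v) + (c₁ + c₂ + c₃) := by ring
    rw [this, pow_add, pow_mul]; simp
  rw [sum_congr rfl key, sum_const, Nat.card_Ico, nsmul_eq_mul, Nat.cast_sub hab, mul_comm]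

lemma sum_range_eq_sum_Ico_four {M : Type*} [AddCommMonoid M] (f : ℕ → M) {a b c d : ℕ}
    (hab : a ≤ b) (hbc : b ≤ c) (hcd : c ≤ d) :
    ∑ y ∈ range d, f y = ∑ y ∈ Ico 0 a, f y + ∑ y ∈ Ico a b, f y + ∑ y ∈ Ico b c, f y +
      ∑ y ∈ Ico c d, f y := by
  rw [sum_Ico_consecutive _ (Nat.zero_le _) hab, sum_Ico_consecutive _ (Nat.zero_le _) hbc,
    sum_Ico_consecutive _ (Nat.zero_le _) hcd, range_eq_Ico]

/-- The correlation sum of the residue signs with lags `0, v, 2v, 3v`. -/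
noncomputable def progressionCorrelation {p : ℕ} [NeZero p] (v : ZMod p) : ℝ :=
  ∑ y, progressionSign y v

section correlation

variable {p v : ℕ} [NeZero p]

/-- The cut points are the `y` at which some `y + j * v` reaches a multiple of `p`. Their order
changes at `v = p/3, p/2, 2p/3`, whence this case and the next three. -/
lemma progressionCorrelation_of_le_third (hp : Odd p) (h : 3 * v ≤ p) :
    progressionCorrelation (v : ZMod p) = p - 4 * v := by
  rw [progressionCorrelation, ← sum_range_natCast_zmod,
    sum_range_eq_sum_Ico_four _ (a := p - 3 * v) (b := p - 2 * v) (c := p - v)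
      (by omega) (by omega) (by omega),
    sum_Ico_progressionSign (c₁ := 0) (c₂ := 0) (c₃ := 0) hp,
    sum_Ico_progressionSign (c₁ := 0) (c₂ := 0) (c₃ := 1) hp,
    sum_Ico_progressionSign (c₁ := 0) (c₂ := 1) (c₃ := 1) hp,
    sum_Ico_progressionSign (c₁ := 1) (c₂ := 1) (c₃ := 1) hp,
    Nat.cast_sub (by omega), Nat.cast_sub (by omega), Nat.cast_sub (by omega)]
  · push_cast; ring
  all_goals omega

lemma progressionCorrelation_of_le_half (hp : Odd p) (h : p ≤ 3 * v) (h' : 2 * v ≤ p) :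
    progressionCorrelation (v : ZMod p) = 8 * v - 3 * p := by
  rw [progressionCorrelation, ← sum_range_natCast_zmod,
    sum_range_eq_sum_Ico_four _ (a := p - 2 * v) (b := p - v) (c := 2 * p - 3 * v)
      (by omega) (by omega) (by omega),
    sum_Ico_progressionSign (c₁ := 0) (c₂ := 0) (c₃ := 1) hp,
    sum_Ico_progressionSign (c₁ := 0) (c₂ := 1) (c₃ := 1) hp,
    sum_Ico_progressionSign (c₁ := 1) (c₂ := 1) (c₃ := 1) hp,
    sum_Ico_progressionSign (c₁ := 1) (c₂ := 1) (c₃ := 2) hp,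
    Nat.cast_sub (by omega), Nat.cast_sub (by omega), Nat.cast_sub (by omega)]
  · push_cast; ring
  all_goals omega

lemma progressionCorrelation_of_half_le (hp : Odd p) (h : p ≤ 2 * v) (h' : 3 * v ≤ 2 * p) :
    progressionCorrelation (v : ZMod p) = 5 * p - 8 * v := by
  rw [progressionCorrelation, ← sum_range_natCast_zmod,
    sum_range_eq_sum_Ico_four _ (a := 2 * p - 3 * v) (b := p - v) (c := 2 * p - 2 * v)
      (by omega) (by omega) (by omega),
    sum_Ico_progressionSign (c₁ := 0) (c₂ := 1) (c₃ := 1) hp,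
    sum_Ico_progressionSign (c₁ := 0) (c₂ := 1) (c₃ := 2) hp,
    sum_Ico_progressionSign (c₁ := 1) (c₂ := 1) (c₃ := 2) hp,
    sum_Ico_progressionSign (c₁ := 1) (c₂ := 2) (c₃ := 2) hp,
    Nat.cast_sub (by omega), Nat.cast_sub (by omega), Nat.cast_sub (by omega)]
  · push_cast; ring
  all_goals omega

lemma progressionCorrelation_of_two_thirds_le (hp : Odd p) (h : 2 * p ≤ 3 * v) (h' : v ≤ p) :
    progressionCorrelation (v : ZMod p) = 4 * v - 3 * p := by
  rw [progressionCorrelation, ← sum_range_natCast_zmod,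
    sum_range_eq_sum_Ico_four _ (a := p - v) (b := 2 * p - 2 * v) (c := 3 * p - 3 * v)
      (by omega) (by omega) (by omega),
    sum_Ico_progressionSign (c₁ := 0) (c₂ := 1) (c₃ := 2) hp,
    sum_Ico_progressionSign (c₁ := 1) (c₂ := 1) (c₃ := 2) hp,
    sum_Ico_progressionSign (c₁ := 1) (c₂ := 2) (c₃ := 2) hp,
    sum_Ico_progressionSign (c₁ := 1) (c₂ := 2) (c₃ := 3) hp,
    Nat.cast_sub (by omega), Nat.cast_sub (by omega), Nat.cast_sub (by omega)]
  · push_cast; ring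
  all_goals omega

end correlation

lemma sum_Ico_linear (α β : ℝ) {a b : ℕ} (h : a ≤ b) :
    ∑ v ∈ Ico a b, (α * v + β) =
      α * ((b : ℝ) * (b - 1) - a * (a - 1)) / 2 + β * (b - a) := by
  induction b, h using Nat.le_induction with
  | base => simp
  | succ n hn ih => rw [sum_Ico_succ_top hn, ih]; push_cast; ring

/-- The four linear pieces have integrals `p²/9, p²/18, p²/18, p²/9`, with total `p²/3`;
discretisation costs `O(p)`. -/
lemma abs_sum_progressionCorrelation_sub_le {p : ℕ} [NeZero p] (hp : Odd p) :
    |∑ v : ZMod p, progressionCorrelation v - (1 / 3 : ℝ) * (p : ℝ) ^ 2| ≤ 4 * p := by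
  have hpos := hp.pos
  have hodd : p % 2 = 1 := Nat.odd_iff.1 hp
  rw [← sum_range_natCast_zmod, sum_range_eq_sum_Ico_four _ (a := p / 3 + 1) (b := p / 2 + 1)
    (c := 2 * p / 3 + 1) (by omega) (by omega) (by omega)]
  have e1 : ∑ v ∈ Ico 0 (p / 3 + 1), progressionCorrelation (v : ZMod p) =
      ∑ v ∈ Ico 0 (p / 3 + 1), ((-4 : ℝ) * v + p) := sum_congr rfl fun v hv => by
    rw [mem_Ico] at hv
    rw [progressionCorrelation_of_le_third hp (by omega)]; ring
  have e2 : ∑ v ∈ Ico (p / 3 + 1) (p / 2 + 1), progressionCorrelation (v : ZMod p) =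
      ∑ v ∈ Ico (p / 3 + 1) (p / 2 + 1), ((8 : ℝ) * v + (-3 * p)) := sum_congr rfl fun v hv => by
    rw [mem_Ico] at hv
    rw [progressionCorrelation_of_le_half hp (by omega) (by omega)]; ring
  have e3 : ∑ v ∈ Ico (p / 2 + 1) (2 * p / 3 + 1), progressionCorrelation (v : ZMod p) =
      ∑ v ∈ Ico (p / 2 + 1) (2 * p / 3 + 1), ((-8 : ℝ) * v + 5 * p) := sum_congr rfl fun v hv => by
    rw [mem_Ico] at hv
    rw [progressionCorrelation_of_half_le hp (by omega) (by omega)]; ring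
  have e4 : ∑ v ∈ Ico (2 * p / 3 + 1) p, progressionCorrelation (v : ZMod p) =
      ∑ v ∈ Ico (2 * p / 3 + 1) p, ((4 : ℝ) * v + (-3 * p)) := sum_congr rfl fun v hv => by
    rw [mem_Ico] at hv
    rw [progressionCorrelation_of_two_thirds_le hp (by omega) (by omega)]; ring
  rw [e1, e2, e3, e4, sum_Ico_linear _ _ (by omega), sum_Ico_linear _ _ (by omega),
    sum_Ico_linear _ _ (by omega), sum_Ico_linear _ _ (by omega)]
  obtain ⟨k, hk⟩ : ∃ k, k = p / 3 := ⟨_, rfl⟩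
  have hq : ((p / 2 : ℕ) : ℝ) = ((p : ℝ) - 1) / 2 := by
    have : p = 2 * (p / 2) + 1 := by omega
    have : (p : ℝ) = 2 * (p / 2 : ℕ) + 1 := by exact_mod_cast this
    linarith
  have hk0 : (0 : ℝ) ≤ k := k.cast_nonneg
  have hp1 : (1 : ℝ) ≤ p := by exact_mod_cast hpos
  have hcases : (p = 3 * k ∧ 2 * p / 3 = 2 * k) ∨ (p = 3 * k + 1 ∧ 2 * p / 3 = 2 * k) ∨
      (p = 3 * k + 2 ∧ 2 * p / 3 = 2 * k + 1) := by omega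
  rw [← hk]
  rcases hcases with ⟨h, h'⟩ | ⟨h, h'⟩ | ⟨h, h'⟩ <;> rw [h'] <;> push_cast <;> rw [hq] <;>
    rw [h] at hp1 ⊢ <;> push_cast at hp1 ⊢ <;> rw [abs_le] <;> constructor <;> nlinarith

/-! ### The Euler quotient and its leading digit -/

lemma eulerQuotient_nonneg {m : ℕ} (hm : m ≠ 0) (n : ℤ) : 0 ≤ eulerQuotient m n := by
  unfold eulerQuotient
  split_ifs
  · exact Int.emod_nonneg _ (by exact_mod_cast hm)
  · exact le_rfl

lemma eulerQuotient_lt {m : ℕ} (hm : m ≠ 0) (n : ℤ) : eulerQuotient m n < m := by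
  unfold eulerQuotient
  split_ifs
  · exact Int.emod_lt_of_pos _ (by exact_mod_cast hm.bot_lt)
  · exact_mod_cast hm.bot_lt

lemma eulerQuotientSeq_eq_zero_iff {m : ℕ} (hm : m ≠ 0) (t : ℕ) :
    eulerQuotientSeq m t = 0 ↔ 2 * eulerQuotient m t < m := by
  have hm' : (0 : ℚ) < m := by exact_mod_cast hm.bot_lt
  have h : (eulerQuotient m t : ℚ) / (m : ℚ) < 1 / 2 ↔ 2 * eulerQuotient m t < m := by
    rw [div_lt_div_iff₀ hm' two_pos, one_mul, mul_comm]
    exact_mod_cast Iff.rfl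
  unfold eulerQuotientSeq
  rw [← h]
  exact ite_eq_left_iff.trans ⟨fun h' => by_contra fun h'' => one_ne_zero (h' h''),
    fun h' h'' => absurd h' h''⟩

lemma eulerQuotientSeq_of_dvd {p r t : ℕ} (hp : p.Prime) (h : p ∣ t) :
    eulerQuotientSeq (p ^ (r + 1)) t = 0 := by
  rw [eulerQuotientSeq_eq_zero_iff (pow_ne_zero _ hp.ne_zero), eulerQuotient, if_neg]
  · exact_mod_cast pow_pos hp.pos _
  · rw [Int.gcd_natCast_natCast]
    exact Nat.not_coprime_of_dvd_of_dvd hp.one_lt h (dvd_pow_self p r.succ_ne_zero)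

/-- The Euler quotient of `n + k m` differs from that of `n` by `φ(m) k n ^ (φ(m) - 1)`
modulo `m`. -/
lemma exists_eulerQuotient_add_mul {m n : ℕ} (hm : m ≠ 0) (h : n.Coprime m) (k : ℕ) :
    ∃ z : ℤ, eulerQuotient m ((n + k * m : ℕ) : ℤ) =
      eulerQuotient m n + m.totient * k * (n : ℤ) ^ (m.totient - 1) + m * z := by
  have hm' : (m : ℤ) ≠ 0 := by exact_mod_cast hm
  have h' : (n + k * m).Coprime m := by simpa using h
  have hdvd : (m : ℤ) ∣ (n : ℤ) ^ m.totient - 1 := by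
    have := (Nat.modEq_iff_dvd.1 (Nat.ModEq.pow_totient h).symm)
    exact_mod_cast this
  obtain ⟨A, hA⟩ := hdvd
  -- The second-order remainder `(k * m) ^ 2 * B` is still divisible by `m` after division by `m`.
  obtain ⟨B, hB⟩ := Polynomial.powAddExpansion (n : ℤ) (k * m : ℤ) m.totient
  obtain ⟨A', hA'⟩ : ∃ A', A' = A + m.totient * k * (n : ℤ) ^ (m.totient - 1) + m * (k ^ 2 * B) :=
    ⟨_, rfl⟩
  have hB' : ((n + k * m : ℕ) : ℤ) ^ m.totient - 1 = m * A' := by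
    push_cast; rw [hB, hA']; linear_combination hA
  rw [eulerQuotient, eulerQuotient, if_pos (by exact h'), if_pos (by exact h), hB', hA,
    Int.mul_ediv_cancel_left _ hm', Int.mul_ediv_cancel_left _ hm']
  have e1 := Int.emod_add_mul_ediv A m
  have e2 := Int.emod_add_mul_ediv A' m
  exact ⟨k ^ 2 * B + A / m - A' / m, by linear_combination e2 - e1 + hA'⟩

/-- Twice the leading base-`p` digit of the Euler quotient modulo `p ^ (r + 1)`. -/
noncomputable def doubledDigit (p r t : ℕ) : ZMod p :=
  2 * ((eulerQuotient (p ^ (r + 1)) t / (p : ℤ) ^ r : ℤ) : ZMod p)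

section prime

variable {p r : ℕ} [hp : Fact p.Prime]

lemma coprime_pow_of_natCast_ne_zero {t : ℕ} (h : (t : ZMod p) ≠ 0) :
    t.Coprime (p ^ (r + 1)) := by
  rw [Ne, ZMod.natCast_eq_zero_iff] at h
  exact (((Nat.Prime.coprime_iff_not_dvd hp.out).2 h).symm).pow_right _

lemma doubledDigit_add_mul_pow {t : ℕ} (h : (t : ZMod p) ≠ 0) (k : ℕ) :
    doubledDigit p r (t + k * p ^ (r + 1)) =
      doubledDigit p r t + k * (-2 * (t : ZMod p)⁻¹) := by
  have hp0 : (p : ℤ) ^ r ≠ 0 := pow_ne_zero _ (by exact_mod_cast hp.out.ne_zero)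
  obtain ⟨z, hz⟩ := exists_eulerQuotient_add_mul (pow_ne_zero (r + 1) hp.out.ne_zero)
    (coprime_pow_of_natCast_ne_zero (r := r) h) k
  have htot : (p ^ (r + 1)).totient = p ^ r * (p - 1) := Nat.totient_prime_pow_succ hp.out r
  have hinv : (t : ZMod p) ^ ((p ^ (r + 1)).totient - 1) = (t : ZMod p)⁻¹ := by
    refine eq_inv_of_mul_eq_one_left ?_
    rw [pow_sub_one_mul (Nat.totient_pos.2 (pow_pos hp.out.pos _)).ne', htot, mul_comm, pow_mul,
      ZMod.pow_card_sub_one_eq_one h, one_pow]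
  have hz' : eulerQuotient (p ^ (r + 1)) ((t + k * p ^ (r + 1) : ℕ) : ℤ) =
      eulerQuotient (p ^ (r + 1)) t + (p : ℤ) ^ r *
        (((p : ℤ) - 1) * k * (t : ℤ) ^ ((p ^ (r + 1)).totient - 1) + p * z) := by
    have hc : (((p ^ (r + 1)).totient : ℕ) : ℤ) = (p : ℤ) ^ r * ((p : ℤ) - 1) := by
      rw [htot]; push_cast [Nat.cast_sub hp.out.one_le]; ring
    rw [hz, hc]; push_cast; ring
  rw [doubledDigit, hz', Int.add_mul_ediv_left _ _ hp0, doubledDigit]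
  push_cast
  rw [hinv, ZMod.natCast_self]
  ring

/-- The sequence agrees in sign with `residueSign` of the doubled digit, unless the leading digit
is the middle one. -/
lemma neg_one_pow_eulerQuotientSeq (hodd : Odd p) {t : ℕ} (h : doubledDigit p r t ≠ -1) :
    (-1 : ℝ) ^ eulerQuotientSeq (p ^ (r + 1)) t = residueSign (doubledDigit p r t) := by
  have hm : p ^ (r + 1) ≠ 0 := pow_ne_zero _ hp.out.ne_zero
  have hP : (0 : ℤ) < (p : ℤ) ^ r := pow_pos (by exact_mod_cast hp.out.pos) _
  have h0 := eulerQuotient_nonneg hm t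
  have h1 := eulerQuotient_lt hm t
  have hs := eulerQuotientSeq_eq_zero_iff hm t
  rw [doubledDigit] at h ⊢
  obtain ⟨Q, hQ⟩ : ∃ Q, Q = eulerQuotient (p ^ (r + 1)) t := ⟨_, rfl⟩
  rw [← hQ] at h h0 h1 hs ⊢
  have hmP : ((p ^ (r + 1) : ℕ) : ℤ) = (p : ℤ) ^ r * p := by push_cast; ring
  rw [hmP] at h1 hs
  obtain ⟨X, hX⟩ := Int.eq_ofNat_of_zero_le (Int.ediv_nonneg h0 hP.le)
  have hlo : (p : ℤ) ^ r * X ≤ Q := by rw [← hX]; exact Int.mul_ediv_self_le hP.ne'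
  have hhi : Q < (p : ℤ) ^ r * (X + 1) := by
    rw [← hX, mul_comm]; exact Int.lt_ediv_add_one_mul_self _ hP
  have hXp : X < p := by
    have : (p : ℤ) ^ r * X < (p : ℤ) ^ r * p := hlo.trans_lt h1
    exact_mod_cast lt_of_mul_lt_mul_left this hP.le
  have hcast : 2 * ((Q / (p : ℤ) ^ r : ℤ) : ZMod p) = ((2 * X : ℕ) : ZMod p) := by
    rw [hX]; push_cast; rfl
  rw [hcast] at h ⊢
  -- The excluded value `-1` is exactly the middle digit `X = (p - 1) / 2`, whose block of quotients
  -- straddles the threshold.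
  have hne : 2 * X + 1 ≠ p := by
    intro he
    apply h
    have : ((2 * X + 1 : ℕ) : ZMod p) = 0 := by rw [he]; simp
    push_cast at this ⊢
    linear_combination this
  rcases lt_or_ge (2 * X) p with hlt | hge
  · have h2 : 2 * (X + 1) ≤ p := by
      obtain ⟨q, hq⟩ := hodd
      omega
    have h2' : (2 : ℤ) * (X + 1) ≤ p := by exact_mod_cast h2
    have : eulerQuotientSeq (p ^ (r + 1)) t = 0 := hs.2 (by
      have := mul_le_mul_of_nonneg_left h2' hP.le
      linarith)
    rw [this, residueSign_natCast (c := 0) hodd (by omega) (by omega)]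
    simp
  · have hge' : (p : ℤ) ≤ 2 * X := by exact_mod_cast hge
    have hne0 : eulerQuotientSeq (p ^ (r + 1)) t ≠ 0 := fun h' => by
      have := mul_le_mul_of_nonneg_left hge' hP.le
      linarith [hs.1 h']
    have : eulerQuotientSeq (p ^ (r + 1)) t = 1 := by
      unfold eulerQuotientSeq at hne0 ⊢
      split_ifs at hne0 ⊢ <;> simp_all
    rw [this, residueSign_natCast (c := 1) hodd (by omega) (by omega), pow_succ _ (2 * X),
      pow_mul]
    simp

lemma abs_neg_one_pow_eulerQuotientSeq_sub_le (hodd : Odd p) (t : ℕ) :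
    |(-1 : ℝ) ^ eulerQuotientSeq (p ^ (r + 1)) t - residueSign (doubledDigit p r t)| ≤
      if doubledDigit p r t = -1 then 2 else 0 := by
  split_ifs with h
  · refine (abs_sub _ _).trans ?_
    rw [abs_residueSign, abs_pow, abs_neg, abs_one, one_pow]; norm_num
  · rw [neg_one_pow_eulerQuotientSeq hodd h, sub_self, abs_zero]

end prime

lemma eulerQuotientSeq_periodic {p : ℕ} (hp : p.Prime) (r : ℕ) :
    Function.Periodic (eulerQuotientSeq (p ^ (r + 1))) (p ^ (r + 2)) := by
  intro t
  have hm : p ^ (r + 1) ≠ 0 := pow_ne_zero _ hp.ne_zero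
  by_cases h : p ∣ t
  · rw [eulerQuotientSeq_of_dvd hp h, eulerQuotientSeq_of_dvd hp
      (dvd_add h (dvd_pow_self p (by omega)))]
  suffices H : eulerQuotient (p ^ (r + 1)) ((t + p * p ^ (r + 1) : ℕ) : ℤ) =
      eulerQuotient (p ^ (r + 1)) t by
    rw [pow_succ' p (r + 1)]
    unfold eulerQuotientSeq; rw [H]
  have hc : t.Coprime (p ^ (r + 1)) := (((Nat.Prime.coprime_iff_not_dvd hp).2 h).symm).pow_right _
  obtain ⟨z, hz⟩ := exists_eulerQuotient_add_mul hm hc p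
  -- For `k = p` the linear term is a multiple of the modulus.
  have htot : (((p ^ (r + 1)).totient : ℕ) : ℤ) * p = (p ^ (r + 1) : ℕ) * ((p - 1 : ℕ) : ℤ) := by
    have : (p ^ (r + 1)).totient * p = p ^ (r + 1) * (p - 1) := by
      rw [Nat.totient_prime_pow_succ hp]; ring
    exact_mod_cast this
  rw [htot, mul_assoc, add_assoc, ← mul_add] at hz
  have := congrArg (· % ((p ^ (r + 1) : ℕ) : ℤ)) hz
  simpa only [Int.add_mul_emod_self_left, Int.emod_eq_of_lt (eulerQuotient_nonneg hm _)
    (eulerQuotient_lt hm _)] using this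

/-! ### From residue classes to the full correlation sum -/

lemma sum_range_mul_eq_sum_sum {M : Type*} [AddCommMonoid M] (f : ℕ → M) (k a : ℕ) :
    ∑ t ∈ range (k * a), f t = ∑ n ∈ range a, ∑ j ∈ range k, f (n + j * a) := by
  induction k with
  | zero => simp
  | succ k ih =>
    rw [add_mul, one_mul, sum_range_add, ih, ← sum_add_distrib]
    refine sum_congr rfl fun n _ => ?_
    rw [sum_range_succ, add_comm n (k * a)]

lemma sum_range_natCast_affine {p : ℕ} [Fact p.Prime] {M : Type*} [AddCommMonoid M]
    (f : ZMod p → M) (b : ZMod p) {w : ZMod p} (hw : w ≠ 0) :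
    ∑ k ∈ range p, f (b + k * w) = ∑ x, f x := by
  rw [sum_range_natCast_zmod fun k => f (b + k * w)]
  exact ((Equiv.mulRight₀ w hw).trans (Equiv.addLeft b)).sum_comp f

lemma sum_range_mul_natCast_zmod {p : ℕ} [NeZero p] (f : ZMod p → ℝ) (k : ℕ) :
    ∑ n ∈ range (k * p), f n = k * ∑ x, f x := by
  rw [sum_range_mul_eq_sum_sum, ← sum_range_natCast_zmod f, mul_sum]
  refine sum_congr rfl fun n _ => ?_
  simp

lemma abs_mul_sub_mul_le {a b a' b' : ℝ} (hb : |b| = 1) (ha' : |a'| = 1) :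
    |a * b - a' * b'| ≤ |a - a'| + |b - b'| := by
  have : a * b - a' * b' = (a - a') * b + a' * (b - b') := by ring
  rw [this]
  refine (abs_add_le _ _).trans ?_
  rw [abs_mul, abs_mul, hb, ha', mul_one, one_mul]

lemma abs_mul_four_sub_le {a b c d a' b' c' d' : ℝ} (hb : |b| = 1) (hc : |c| = 1)
    (hd : |d| = 1) (ha' : |a'| = 1) (hb' : |b'| = 1) (hc' : |c'| = 1) :
    |a * b * c * d - a' * b' * c' * d'| ≤ |a - a'| + |b - b'| + |c - c'| + |d - d'| := by
  have h1 := abs_mul_sub_mul_le (a := a) (b' := b') hb ha'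
  have h2 := abs_mul_sub_mul_le (a := a * b) (a' := a' * b') (b' := c') hc (by simp [abs_mul, *])
  have h3 := abs_mul_sub_mul_le (a := a * b * c) (a' := a' * b' * c') (b' := d') hd
    (by simp [abs_mul, *])
  linarith

section prime

variable {p : ℕ} [hp : Fact p.Prime]

/-- The correlation over one residue class modulo `p ^ (r + 1)`. -/
lemma abs_sum_eulerQuotientSeq_sub_progressionCorrelation_le (hodd : Odd p) (r n : ℕ) :
    |∑ k ∈ range p, (-1 : ℝ) ^ (eulerQuotientSeq (p ^ (r + 1)) (n + k * p ^ (r + 1)) +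
        eulerQuotientSeq (p ^ (r + 1)) (n + k * p ^ (r + 1) + p ^ (r + 1)) +
        eulerQuotientSeq (p ^ (r + 1)) (n + k * p ^ (r + 1) + 2 * p ^ (r + 1)) +
        eulerQuotientSeq (p ^ (r + 1)) (n + k * p ^ (r + 1) + 3 * p ^ (r + 1))) -
      progressionCorrelation (-2 * (n : ZMod p)⁻¹)| ≤ 8 := by
  obtain ⟨m, hm⟩ : ∃ m, m = p ^ (r + 1) := ⟨_, rfl⟩
  have hpm : p ∣ m := hm ▸ dvd_pow_self p r.succ_ne_zero
  -- When `p ∣ n` the sequence vanishes on the class, and the convention `0⁻¹ = 0` makes the step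
  -- zero, so both sides equal `p`.
  by_cases hn : (n : ZMod p) = 0
  · have hpn : p ∣ n := (ZMod.natCast_eq_zero_iff _ _).1 hn
    have hF : progressionCorrelation (0 : ZMod p) = p := by
      simpa using progressionCorrelation_of_le_third (v := 0) hodd (by omega)
    have hs : ∀ k j : ℕ, eulerQuotientSeq (p ^ (r + 1)) (n + k * m + j * m) = 0 := fun k j =>
      eulerQuotientSeq_of_dvd hp.out
        (dvd_add (dvd_add hpn (hpm.mul_left k)) (hpm.mul_left j))
    have hs0 := fun k => hs k 0
    have hs1 := fun k => hs k 1
    simp only [zero_mul, one_mul, add_zero] at hs0 hs1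
    simp only [← hm] at hs hs0 hs1 ⊢
    simp [hs, hs0, hs1, hn, hF]
  obtain ⟨w, hw⟩ : ∃ w, w = -2 * (n : ZMod p)⁻¹ := ⟨_, rfl⟩
  obtain ⟨a, ha⟩ : ∃ a, a = doubledDigit p r n := ⟨_, rfl⟩
  have hw0 : w ≠ 0 := by
    have h2 : (2 : ZMod p) ≠ 0 := by
      intro h
      have h' : ((2 : ℕ) : ZMod p) = 0 := by exact_mod_cast h
      have := Nat.le_of_dvd two_pos ((ZMod.natCast_eq_zero_iff _ _).1 h')
      have := hp.out.two_le
      obtain ⟨q, hq⟩ := hodd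
      omega
    rw [hw]
    exact mul_ne_zero (neg_ne_zero.2 h2) (inv_ne_zero hn)
  have hdig : ∀ k : ℕ, doubledDigit p r (n + k * m) = a + k * w := fun k => by
    rw [hm, hw, ha, doubledDigit_add_mul_pow hn]
  have hclose : ∀ k j : ℕ,
      |(-1 : ℝ) ^ eulerQuotientSeq m (n + k * m + j * m) -
          residueSign (a + (k : ZMod p) * w + (j : ZMod p) * w)| ≤
        if a + j * w + k * w = -1 then 2 else 0 := fun k j => by
    have h := abs_neg_one_pow_eulerQuotientSeq_sub_le (r := r) hodd (n + (k + j) * m)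
    rw [hdig, ← hm, add_mul, ← add_assoc] at h
    have e : a + ((k + j : ℕ) : ZMod p) * w = a + k * w + j * w := by push_cast; ring
    rw [e] at h
    rwa [add_right_comm a ((j : ZMod p) * w)]
  -- As `w ≠ 0`, each factor meets the middle digit for exactly one `k`; four factors give the total
  -- error 8.
  have hcount : ∀ j : ℕ, ∑ k ∈ range p, (if a + j * w + k * w = -1 then (2 : ℝ) else 0) = 2 :=
    fun j => by
      rw [sum_range_natCast_affine (fun x => if x = -1 then (2 : ℝ) else 0) _ hw0]
      simp
  rw [← hw, ← hm, progressionCorrelation,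
    ← sum_range_natCast_affine (fun y => progressionSign y w) a hw0, ← sum_sub_distrib]
  refine (abs_sum_le_sum_abs _ _).trans ?_
  calc _ ≤ ∑ k ∈ range p, ((if a + (0 : ℕ) * w + k * w = -1 then (2 : ℝ) else 0) +
        (if a + (1 : ℕ) * w + k * w = -1 then 2 else 0) +
        (if a + (2 : ℕ) * w + k * w = -1 then 2 else 0) +
        (if a + (3 : ℕ) * w + k * w = -1 then 2 else 0)) := by
        refine sum_le_sum fun k _ => ?_
        have h0 := hclose k 0
        have h1 := hclose k 1
        have h2 := hclose k 2
        have h3 := hclose k 3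
        refine le_trans ?_ (add_le_add (add_le_add (add_le_add h0 h1) h2) h3)
        rw [pow_add, pow_add, pow_add, progressionSign]
        refine le_trans (abs_mul_four_sub_le ?_ ?_ ?_ ?_ ?_ ?_) (le_of_eq ?_)
        iterate 3 simp
        iterate 3 exact abs_residueSign _
        simp
    _ = 8 := by
        rw [sum_add_distrib, sum_add_distrib, sum_add_distrib, hcount, hcount, hcount, hcount]
        norm_num

lemma abs_sum_eulerQuotientSeq_sub_le (hodd : Odd p) (r : ℕ) :
    |∑ t ∈ range (p ^ (r + 2)), (-1 : ℝ) ^ (eulerQuotientSeq (p ^ (r + 1)) t +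
        eulerQuotientSeq (p ^ (r + 1)) (t + p ^ (r + 1)) +
        eulerQuotientSeq (p ^ (r + 1)) (t + 2 * p ^ (r + 1)) +
        eulerQuotientSeq (p ^ (r + 1)) (t + 3 * p ^ (r + 1))) -
      (1 / 3 : ℝ) * (p : ℝ) ^ (r + 2)| ≤ 12 * (p : ℝ) ^ (r + 1) := by
  -- Inversion, with `0⁻¹ = 0`, and multiplication by `-2` permute `ZMod p`, so every step occurs `p
  -- ^ r` times.
  have hF : ∑ n ∈ range (p ^ (r + 1)), progressionCorrelation (-2 * (n : ZMod p)⁻¹) =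
      (p : ℝ) ^ r * ∑ v : ZMod p, progressionCorrelation v := by
    have h2 : (-2 : ZMod p) ≠ 0 := by
      intro h
      have h' : ((2 : ℕ) : ZMod p) = 0 := by simpa using h
      have := Nat.le_of_dvd two_pos ((ZMod.natCast_eq_zero_iff _ _).1 h')
      have := hp.out.two_le
      obtain ⟨q, hq⟩ := hodd
      omega
    rw [pow_succ, sum_range_mul_natCast_zmod (fun x => progressionCorrelation (-2 * x⁻¹)),
      ← ((Equiv.inv (ZMod p)).trans (Equiv.mulLeft₀ _ h2)).sum_comp progressionCorrelation]
    simp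
  have h1 : |∑ t ∈ range (p ^ (r + 2)), (-1 : ℝ) ^ (eulerQuotientSeq (p ^ (r + 1)) t +
        eulerQuotientSeq (p ^ (r + 1)) (t + p ^ (r + 1)) +
        eulerQuotientSeq (p ^ (r + 1)) (t + 2 * p ^ (r + 1)) +
        eulerQuotientSeq (p ^ (r + 1)) (t + 3 * p ^ (r + 1))) -
      (p : ℝ) ^ r * ∑ v : ZMod p, progressionCorrelation v| ≤ 8 * (p : ℝ) ^ (r + 1) := by
    rw [← hF, pow_succ' p (r + 1), sum_range_mul_eq_sum_sum, ← sum_sub_distrib]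
    refine (abs_sum_le_sum_abs _ _).trans ((sum_le_sum fun n _ =>
      abs_sum_eulerQuotientSeq_sub_progressionCorrelation_le hodd r n).trans_eq ?_)
    simp [mul_comm]
  have h2 : |(p : ℝ) ^ r * ∑ v : ZMod p, progressionCorrelation v -
      (1 / 3 : ℝ) * (p : ℝ) ^ (r + 2)| ≤ 4 * (p : ℝ) ^ (r + 1) := by
    have e : (p : ℝ) ^ r * ∑ v : ZMod p, progressionCorrelation v -
        (1 / 3 : ℝ) * (p : ℝ) ^ (r + 2) = (p : ℝ) ^ r *
        (∑ v : ZMod p, progressionCorrelation v - (1 / 3 : ℝ) * (p : ℝ) ^ 2) := by ring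
    have hP : (0 : ℝ) ≤ (p : ℝ) ^ r := by positivity
    rw [e, abs_mul, abs_of_nonneg hP]
    refine (mul_le_mul_of_nonneg_left (abs_sum_progressionCorrelation_sub_le hodd) hP).trans_eq ?_
    ring
  refine (abs_sub_le _ _ _).trans ((add_le_add h1 h2).trans_eq ?_)
  ring

end prime

/-! ### The correlation measure and the final bounds -/

lemma le_periodicCorrelationMeasure (s : ℕ → ℕ) {T k : ℕ} (d : Fin k ↪o Fin T) :
    |∑ n ∈ range T, (-1 : ℝ) ^ (∑ i : Fin k, s (n + (d i : ℕ)))| ≤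
      periodicCorrelationMeasure s T k :=
  le_ciSup (f := fun d : Fin k ↪o Fin T =>
    |∑ n ∈ range T, (-1 : ℝ) ^ (∑ i : Fin k, s (n + (d i : ℕ)))|)
    (Set.finite_range _).bddAbove d

lemma periodicCorrelationMeasure_nonneg (s : ℕ → ℕ) (T k : ℕ) :
    0 ≤ periodicCorrelationMeasure s T k :=
  Real.iSup_nonneg fun _ => abs_nonneg _

/-- The lags `0, m, 2m, 3m` bound the correlation measure of order four from below. -/
lemma sum_le_periodicCorrelationMeasure_four (s : ℕ → ℕ) {T m : ℕ} (hm : 0 < m)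
    (hT : 3 * m < T) :
    ∑ t ∈ range T, (-1 : ℝ) ^ (s t + s (t + m) + s (t + 2 * m) + s (t + 3 * m)) ≤
      periodicCorrelationMeasure s T 4 := by
  have hlt : ∀ i : Fin 4, (i : ℕ) * m < T := fun i =>
    (Nat.mul_le_mul_right m (by omega : (i : ℕ) ≤ 3)).trans_lt hT
  have hmono : StrictMono fun i : Fin 4 => (⟨i * m, hlt i⟩ : Fin T) := fun i j hij =>
    Fin.mk_lt_mk.2 (Nat.mul_lt_mul_of_pos_right hij hm)
  refine le_trans (le_of_eq ?_) ((le_abs_self _).trans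
    (le_periodicCorrelationMeasure s (OrderEmbedding.ofStrictMono _ hmono)))
  refine sum_congr rfl fun t _ => ?_
  simp [Fin.sum_univ_four]

lemma pow_le_rpow_mul_log_pow_four {p τ : ℕ} (hp : 2 < p) (hτ : 1 ≤ τ) :
    (p : ℝ) ^ τ ≤ (p : ℝ) ^ ((τ : ℝ) + 1 / 2) * Real.log ((p : ℝ) ^ τ) ^ 4 := by
  have hp3 : (3 : ℝ) ≤ p := by exact_mod_cast hp
  have h1 : (p : ℝ) ^ τ ≤ (p : ℝ) ^ ((τ : ℝ) + 1 / 2) := by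
    rw [← Real.rpow_natCast]
    exact Real.rpow_le_rpow_of_exponent_le (by linarith) (by linarith)
  -- This rests on `p ≥ 3 > e`.
  have h2 : 1 ≤ Real.log ((p : ℝ) ^ τ) := by
    rw [Real.le_log_iff_exp_le (by positivity)]
    calc Real.exp 1 ≤ 3 := Real.exp_one_lt_three.le
      _ ≤ p := hp3
      _ ≤ (p : ℝ) ^ τ := le_self_pow₀ (by linarith) (by omega)
  exact h1.trans (le_mul_of_one_le_right (by positivity) (one_le_pow₀ h2))

theorem corollary1 :
    ∃ C : ℝ, 0 < C ∧ ∀ p τ : ℕ, p.Prime → 2 < p → 1 ≤ τ →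
      Function.Periodic (eulerQuotientSeq (p ^ τ)) (p ^ (τ + 1)) ∧
      |(∑ t ∈ Finset.range (p ^ (τ + 1)),
          (-1 : ℝ) ^ (eulerQuotientSeq (p ^ τ) t + eulerQuotientSeq (p ^ τ) (t + p ^ τ) +
            eulerQuotientSeq (p ^ τ) (t + 2 * p ^ τ) + eulerQuotientSeq (p ^ τ) (t + 3 * p ^ τ))) -
          (1 / 3 : ℝ) * (p : ℝ) ^ (τ + 1)| ≤
        C * ((p : ℝ) ^ ((τ : ℝ) + 1 / 2) * Real.log ((p : ℝ) ^ τ) ^ 4) ∧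
      (1 / 3 : ℝ) * (p : ℝ) ^ (τ + 1) -
          C * ((p : ℝ) ^ ((τ : ℝ) + 1 / 2) * Real.log ((p : ℝ) ^ τ) ^ 4) ≤
        periodicCorrelationMeasure (eulerQuotientSeq (p ^ τ)) (p ^ (τ + 1)) 4 := by
  refine ⟨12, by norm_num, fun p τ hp hp2 hτ => ?_⟩
  have hE := pow_le_rpow_mul_log_pow_four hp2 hτ
  obtain ⟨r, rfl⟩ : ∃ r, τ = r + 1 := ⟨τ - 1, by omega⟩
  have : Fact p.Prime := ⟨hp⟩
  have hsum := (abs_sum_eulerQuotientSeq_sub_le (hp.odd_of_ne_two hp2.ne') r).trans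
    (mul_le_mul_of_nonneg_left hE (by norm_num))
  refine ⟨eulerQuotientSeq_periodic hp r, hsum, ?_⟩
  -- For `p = 3` the lag `3 * p ^ τ` equals the period and is not admissible; but then the main term
  -- is just `p ^ τ`, so the lower bound is negative.
  rcases Nat.lt_or_ge 3 p with h3 | h3
  · have hlag : 3 * p ^ (r + 1) < p ^ (r + 1 + 1) := by
      rw [pow_succ' p (r + 1)]
      exact Nat.mul_lt_mul_of_pos_right h3 (pow_pos hp.pos _)
    have hθ := sum_le_periodicCorrelationMeasure_four (eulerQuotientSeq (p ^ (r + 1)))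
      (pow_pos hp.pos (r + 1)) hlag
    linarith [(abs_le.1 hsum).1]
  · have hp3 : (p : ℝ) = 3 := by exact_mod_cast (by omega : p = 3)
    have hmain : (1 / 3 : ℝ) * (p : ℝ) ^ (r + 1 + 1) = (p : ℝ) ^ (r + 1) := by
      rw [pow_succ _ (r + 1), hp3]; ring
    have hpos : (0 : ℝ) < (p : ℝ) ^ (r + 1) := pow_pos (by exact_mod_cast hp.pos) _
    have := periodicCorrelationMeasure_nonneg (eulerQuotientSeq (p ^ (r + 1))) (p ^ (r + 1 + 1)) 4
    linarith
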